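/- Let $p,q\ge 0$ be integers with $n=p+q$ odd, let $\eta=\mathrm{diag}(1,\dots,1,-1,\dots,-1)$ ($p$ entries $+1$, $q$ entries $-1$), and let $\mathcal{C}\ell(p,q)$ be the real Clifford algebra with identity $e$ and generators $e^1,\dots,e^n$, $e^ae^b+e^be^a=2\eta^{ab}e$. For $x^1,\dots,x^n\in\mathcal{C}\ell(p,q)$ and an ordered multi-index $A=a_1\dots a_k$, $1\le a_1<\dots<a_k\le n$, $0\le k\le n$, put $|A|=k$ and $x^A=x^{a_1}\cdots x^{a_k}$ ($x^{\varnothing}=e$), and write $x_A=(x^A)^{-1}$ when $x^A$ is invertible. Say that $x^1,\dots,x^n$ generate a basis if the $2^n$ elements $x^A$ form a basis of $\mathcal{C}\ell(p,q)$. Suppose that $\gamma^a,\beta^a\in\mathcal{C}\ell(p,q)$, $a=1,\dots,n$, satisfy $$\gamma^a\gamma^b+\gamma^b\gamma^a=2\eta^{ab}e,\qquad \beta^a\beta^b+\beta^b\beta^a=2\eta^{ab}e\qquad(a,b=1,\dots,n)$$ (so all $\gamma^A,\beta^A$ are invertible). For an element $c\in\{e,-e,e^{1\dots n},-e^{1\dots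 n}\}$ consider, for invertible $T\in\mathcal{C}\ell(p,q)$, the relation $$(R_c)\qquad \gamma^a=c\,T^{-1}\beta^aT\qquad\text{for all }a=1,\dots,n.$$ (i) If $p-q\equiv1\pmod 4$, then for each of the two sets the top product ($\gamma^{1\dots n}$, respectively $\beta^{1\dots n}$) either equals $\pm e^{1\dots n}$ and the set generates a basis, or equals $\pm e$ and the set does not generate a basis. Exactly one of the four equalities $\beta^{1\dots n}=c\,\gamma^{1\dots n}$, $c\in\{e,-e,e^{1\dots n},-e^{1\dots n}\}$, holds. (ii) If $p-q\equiv3\pmod 4$, then $\gamma^{1\dots n}$ and $\beta^{1\dots n}$ both lie in $\{e^{1\dots n},-e^{1\dots n}\}$ and both sets generate bases. Exactly one of $\beta^{1\dots n}=\gamma^{1\dots n}$, $\beta^{1\dots n}=-\gamma^{1\dots n}$ holds; for $c=\pm e^{1\dots n}$ neither $\beta^{1\dots n}=c\,\gamma^{1\dots n}$ nor $(R_c)$ for any $T$ is possible. (iii) For each $c\in\{e,-e,e^{1\dots n},-e^{1\dots n}\}$: an invertible $T$ satisfying $(R_c)$ exists if and only if $\beta^{1\dots n}=c\,\gamma^{1\dots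 n}$, and then $T$ is unique up to multiplication by an invertible element of the center: the solutions of $(R_c)$ are exactly the elements $ZT$ with $Z$ central and invertible. (iv) An invertible $T$ satisfies one of the four relations $(R_c)$ if and only if $\gamma^a=(\beta^{1\dots n}\gamma_{1\dots n})\,T^{-1}\beta^aT$ for all $a$. (v) Let $H_{\mathrm{Even}}(U)=2^{1-n}\sum_{|A|\text{ even}}\beta^AU\gamma_A$. If $p-q\equiv1\pmod4$, there are multi-indices $A,B$ of even length (possibly equal) such that $T=H_{\mathrm{Even}}(\gamma^A+\gamma^B)$ is invertible and satisfies $(R_c)$ for the $c$ with $\beta^{1\dots n}=c\,\gamma^{1\dots n}$. If $p-q\equiv3\pmod4$, there is a multi-index $A$ of even length with $H_{\mathrm{Even}}(\gamma^A)\ne0$, and for every such $A$ the element $T=H_{\mathrm{Even}}(\gamma^A)$ is invertible and satisfies $(R_c)$ for the $c\in\{e,-e\}$ with $\beta^{1\dots n}=c\,\gamma^{1\dots n}$. -/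

import Mathlib

noncomputable section

namespace PauliOdd

/-- The diagonal entries of `η`: the first `p` are `+1`, the last `q` are `-1`. -/
def sgn (p q : ℕ) (a : Fin (p + q)) : ℝ := if (a : ℕ) < p then 1 else -1

/-- The matrix `η = diag(1, …, 1, -1, …, -1)`. -/
def eta (p q : ℕ) : Matrix (Fin (p + q)) (Fin (p + q)) ℝ := Matrix.diagonal (sgn p q)

/-- The real Clifford algebra of signature `(p, q)`: the Clifford algebra of the quadratic form
`x ↦ ∑ a, η^{aa} x_a ^ 2` on `ℝ^(p+q)`. -/
abbrev Cl (p q : ℕ) : Type :=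
  CliffordAlgebra (QuadraticMap.weightedSumSquares ℝ (sgn p q))

variable {p q : ℕ}

/-- The standard generators `e^a`. -/
def gen (p q : ℕ) (a : Fin (p + q)) : Cl p q :=
  CliffordAlgebra.ι (QuadraticMap.weightedSumSquares ℝ (sgn p q)) (Pi.single a 1)

/-- `γ^a γ^b + γ^b γ^a = 2 η^{ab} e` for all `a`, `b`. -/
def CliffordRelations (γ : Fin (p + q) → Cl p q) : Prop :=
  ∀ a b, γ a * γ b + γ b * γ a = (2 * eta p q a b) • (1 : Cl p q)

/-- `γ^A = γ^{a_1} ⋯ γ^{a_k}` for the ordered multi-index `A = a_1 < ⋯ < a_k`, encoded as the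
finite set of its entries. -/
def up (γ : Fin (p + q) → Cl p q) (A : Finset (Fin (p + q))) : Cl p q :=
  ((A.sort (· ≤ ·)).map γ).prod

/-- `γ_A = (γ^A)⁻¹`. (Under `CliffordRelations γ` every `γ^A` is invertible.) -/
def down (γ : Fin (p + q) → Cl p q) (A : Finset (Fin (p + q))) : Cl p q :=
  Ring.inverse (up γ A)

/-- `γ^{1…n}`. -/
def top (γ : Fin (p + q) → Cl p q) : Cl p q := up γ Finset.univ

/-- `e^{1…n}`. -/
def vol (p q : ℕ) : Cl p q := top (gen p q)

/-- The family `γ^A`, over all multi-indices `A`, is a basis of the Clifford algebra. -/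
def GeneratesBasis (γ : Fin (p + q) → Cl p q) : Prop :=
  LinearIndependent ℝ (up γ) ∧ Submodule.span ℝ (Set.range (up γ)) = ⊤

/-- `γ^a = c T⁻¹ β^a T` for all `a`. -/
def Connects (c : Cl p q) (β γ : Fin (p + q) → Cl p q) (T : (Cl p q)ˣ) : Prop :=
  ∀ a, γ a = c * ((↑T⁻¹ : Cl p q) * β a * (T : Cl p q))

/-- `H_Even(U) = 2^{-(n-1)} ∑_{|A| even} β^A U γ_A`. -/
def HEven (β γ : Fin (p + q) → Cl p q) (U : Cl p q) : Cl p q :=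
  ((1 : ℝ) / 2 ^ (p + q - 1)) •
    ∑ A : Finset (Fin (p + q)) with Even A.card, up β A * U * down γ A

end PauliOdd

end

noncomputable section

namespace PauliOdd

open scoped symmDiff

variable {p q : ℕ}

/-! ### Products over multi-indices -/

/-! The proof avoids representation theory: it studies the space of intertwiners `β^A T = T γ^A`,
`|A|` even, and computes its dimension as a trace.

`HEven β γ` is a projection onto this space (`intertwines_hEven`, `Intertwines.hEven_eq`). Its
summand `U ↦ β^A U γ_A` is traceless for even nonempty `A`, because `β^A` anticommutes with `β^a`
for `a ∈ A`; only `A = ∅` contributes, and the trace is `2^n / 2^(n-1) = 2`. Hence the intertwiners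
form a plane (`finrank_intertwiners`). For `β = γ` it contains `e` and `e^{1…n}`, which are
independent, so it is their span (`Intertwines.exists_eq`). In particular `γ^{1…n} = r e + t
e^{1…n}`, and its known square determines `r` and `t`.

If `T` is a nonzero intertwiner, some product `T X` is a nonzero element of that span
(`Intertwines.exists_mul_ne_zero`). When `p - q ≡ 3` the span is a copy of `ℂ`, so `T` is
invertible. When `p - q ≡ 1` it is `ℝ × ℝ`, and `T` is invertible once both idempotents `(e ±
e^{1…n})/2` leave it nonzero; this explains the sum of two terms in the explicit formula.

As `n` is odd, `γ^a` is up to sign the central element `γ^{1…n}` times an even product. An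
invertible intertwiner therefore satisfies `(R_c)` as soon as `β^{1…n} = c γ^{1…n}` and `c² = e`
(`Intertwines.connects`). Multiplying the relations `(R_c)` together gives the converse. -/

lemma sgn_mul_self (a : Fin (p + q)) : sgn p q a * sgn p q a = 1 := by
  unfold sgn; split_ifs <;> norm_num

lemma CliffordRelations.mul_self {γ : Fin (p + q) → Cl p q} (hγ : CliffordRelations γ)
    (a : Fin (p + q)) : γ a * γ a = sgn p q a • (1 : Cl p q) := by
  have h := hγ a a
  rw [eta, Matrix.diagonal_apply_eq, ← two_smul ℝ (γ a * γ a), mul_smul] at h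
  exact smul_right_injective _ (two_ne_zero' ℝ) h

lemma CliffordRelations.anticomm {γ : Fin (p + q) → Cl p q} (hγ : CliffordRelations γ)
    {a b : Fin (p + q)} (hab : a ≠ b) : γ a * γ b = -(γ b * γ a) := by
  have h := hγ a b
  rw [eta, Matrix.diagonal_apply_ne _ hab, mul_zero, zero_smul] at h
  exact eq_neg_of_add_eq_zero_left h

lemma up_empty (γ : Fin (p + q) → Cl p q) : up γ ∅ = 1 := by
  simp [up]

lemma up_singleton (γ : Fin (p + q) → Cl p q) (a : Fin (p + q)) : up γ {a} = γ a := by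
  simp [up]

lemma up_insert (γ : Fin (p + q) → Cl p q) {a : Fin (p + q)} {A : Finset (Fin (p + q))}
    (h : ∀ b ∈ A, a < b) : up γ (insert a A) = γ a * up γ A := by
  have ha : a ∉ A := fun h' => lt_irrefl _ (h a h')
  rw [up, Finset.sort_insert _ (fun b hb => (h b hb).le) ha, List.map_cons, List.prod_cons, up]

/-- Moving a generator past `γ^A` costs one sign for each entry of `A` other than it. -/
lemma CliffordRelations.mul_up {γ : Fin (p + q) → Cl p q} (hγ : CliffordRelations γ)
    (a : Fin (p + q)) (A : Finset (Fin (p + q))) :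
    γ a * up γ A = ((-1 : ℝ) ^ (A.erase a).card) • (up γ A * γ a) := by
  induction A using Finset.induction_on_min with
  | empty => simp [up_empty]
  | insert m A hm ih =>
    have hmA : m ∉ A := fun h' => lt_irrefl _ (hm m h')
    rw [up_insert γ hm]
    by_cases h : a = m
    · subst h
      rw [Finset.erase_insert hmA]
      rw [Finset.erase_eq_of_notMem hmA] at ih
      rw [mul_assoc (γ a), ← mul_smul_comm, ← ih]
    · rw [Finset.erase_insert_of_ne (Ne.symm h),
        Finset.card_insert_of_notMem (fun h' => hmA (Finset.mem_of_mem_erase h')),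
        ← mul_assoc, hγ.anticomm h, neg_mul, mul_assoc, ih, pow_succ, mul_smul_comm, mul_assoc]
      simp

/-- A generator times `γ^A` is, up to a sign independent of `γ`, again some `γ^B`. -/
lemma exists_sign_mul_up (a : Fin (p + q)) (A : Finset (Fin (p + q))) :
    ∃ s : ℝ, s * s = 1 ∧ ∀ γ : Fin (p + q) → Cl p q, CliffordRelations γ →
      γ a * up γ A = s • up γ ({a} ∆ A) := by
  induction A using Finset.induction_on_min with
  | empty => exact ⟨1, by norm_num, fun γ _ => by
      rw [up_empty, ← Finset.bot_eq_empty, symmDiff_bot, up_singleton, mul_one, one_smul]⟩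
  | insert m A hm ih =>
    have hmA : m ∉ A := fun h' => lt_irrefl _ (hm m h')
    rcases lt_trichotomy a m with h | h | h
    · have hlt : ∀ b ∈ insert m A, a < b := by
        intro b hb
        rcases Finset.mem_insert.1 hb with rfl | hb
        · exact h
        · exact h.trans (hm b hb)
      refine ⟨1, by norm_num, fun γ _ => ?_⟩
      have : {a} ∆ insert m A = insert a (insert m A) := by
        ext x
        have : x = a → x ∉ insert m A := by
          rintro rfl h'; exact lt_irrefl _ (hlt _ h')
        simp only [Finset.mem_symmDiff, Finset.mem_singleton, Finset.mem_insert] at this ⊢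
        tauto
      rw [this, up_insert γ hlt, one_smul]
    · subst h
      refine ⟨sgn p q a, sgn_mul_self a, fun γ hγ => ?_⟩
      have : {a} ∆ insert a A = A := by
        ext x
        have : x = a → x ∉ A := by rintro rfl; exact hmA
        simp only [Finset.mem_symmDiff, Finset.mem_singleton, Finset.mem_insert]
        tauto
      rw [this, up_insert γ hm, ← mul_assoc, hγ.mul_self, smul_mul_assoc, one_mul]
    · obtain ⟨s, hs, H⟩ := ih
      refine ⟨-s, by simpa using hs, fun γ hγ => ?_⟩
      have hlt : ∀ b ∈ {a} ∆ A, m < b := by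
        intro b hb
        rw [Finset.mem_symmDiff, Finset.mem_singleton] at hb
        rcases hb with ⟨rfl, -⟩ | ⟨hb, -⟩
        · exact h
        · exact hm b hb
      have : {a} ∆ insert m A = insert m ({a} ∆ A) := by
        ext x
        have h1 : x = m → x ≠ a := by rintro rfl; exact h.ne
        simp only [Finset.mem_symmDiff, Finset.mem_singleton, Finset.mem_insert]
        tauto
      rw [this, up_insert γ hlt, up_insert γ hm, ← mul_assoc, hγ.anticomm h.ne', neg_mul,
        mul_assoc, H γ hγ, mul_smul_comm, neg_smul]

/-- `γ^B γ^A = ± γ^{B ∆ A}` with a sign independent of `γ`. -/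
lemma exists_sign_up_mul_up (B A : Finset (Fin (p + q))) :
    ∃ s : ℝ, s * s = 1 ∧ ∀ γ : Fin (p + q) → Cl p q, CliffordRelations γ →
      up γ B * up γ A = s • up γ (B ∆ A) := by
  induction B using Finset.induction_on_min with
  | empty => exact ⟨1, by norm_num, fun γ _ => by
      rw [up_empty, ← Finset.bot_eq_empty, bot_symmDiff, one_mul, one_smul]⟩
  | insert m B hm ih =>
    obtain ⟨s, hs, H⟩ := ih
    obtain ⟨t, ht, K⟩ := exists_sign_mul_up m (B ∆ A)
    refine ⟨s * t, by linear_combination t * t * hs + ht, fun γ hγ => ?_⟩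
    have : insert m B = {m} ∆ B := by
      ext x
      have : x = m → x ∉ B := by rintro rfl h; exact lt_irrefl _ (hm _ h)
      simp only [Finset.mem_symmDiff, Finset.mem_singleton, Finset.mem_insert]
      tauto
    rw [up_insert γ hm, mul_assoc, H γ hγ, mul_smul_comm, K γ hγ, smul_smul, this, symmDiff_assoc]

lemma CliffordRelations.isUnit_up {γ : Fin (p + q) → Cl p q} (hγ : CliffordRelations γ)
    (A : Finset (Fin (p + q))) : IsUnit (up γ A) := by
  obtain ⟨s, hs, H⟩ := exists_sign_up_mul_up A A
  have h := H γ hγ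
  rw [symmDiff_self, Finset.bot_eq_empty, up_empty] at h
  refine ⟨⟨up γ A, s • up γ A, ?_, ?_⟩, rfl⟩
  · rw [mul_smul_comm, h, smul_smul, hs, one_smul]
  · rw [smul_mul_assoc, h, smul_smul, hs, one_smul]

lemma CliffordRelations.up_mul_down {γ : Fin (p + q) → Cl p q} (hγ : CliffordRelations γ)
    (A : Finset (Fin (p + q))) : up γ A * down γ A = 1 :=
  Ring.mul_inverse_cancel _ (hγ.isUnit_up A)

lemma CliffordRelations.down_mul_up {γ : Fin (p + q) → Cl p q} (hγ : CliffordRelations γ)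
    (A : Finset (Fin (p + q))) : down γ A * up γ A = 1 :=
  Ring.inverse_mul_cancel _ (hγ.isUnit_up A)

lemma down_empty (γ : Fin (p + q) → Cl p q) : down γ ∅ = 1 := by
  rw [down, up_empty, Ring.inverse_one]

/-- `γ_A γ_B` is the inverse of `γ^B γ^A`. -/
lemma CliffordRelations.down_mul_down {γ : Fin (p + q) → Cl p q} (hγ : CliffordRelations γ)
    {A B : Finset (Fin (p + q))} {s : ℝ} (hs : s * s = 1)
    (h : up γ B * up γ A = s • up γ (B ∆ A)) :
    down γ A * down γ B = s • down γ (B ∆ A) := by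
  refine left_inv_eq_right_inv (a := up γ B * up γ A) ?_ ?_
  · rw [mul_assoc, ← mul_assoc (down γ B), hγ.down_mul_up, one_mul, hγ.down_mul_up]
  · rw [h, smul_mul_smul_comm, hs, one_smul, hγ.up_mul_down]

/-- `γ^A` is a multiple of `γ^{1…n}` times the complementary product, with a factor independent
of `γ`. -/
lemma exists_sign_top_mul_up_compl (A : Finset (Fin (p + q))) :
    ∃ s : ℝ, s * s = 1 ∧ ∀ γ : Fin (p + q) → Cl p q, CliffordRelations γ →
      up γ A = s • (top γ * up γ Aᶜ) := by
  obtain ⟨s, hs, H⟩ := exists_sign_up_mul_up Finset.univ Aᶜ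
  refine ⟨s, hs, fun γ hγ => ?_⟩
  have : Finset.univ ∆ Aᶜ = A := by
    ext x; simp [Finset.mem_symmDiff]
  rw [top, H γ hγ, this, smul_smul, hs, one_smul]

lemma up_central_mul {γ δ : Fin (p + q) → Cl p q} {c : Cl p q} (hc : ∀ x, Commute c x)
    (h : ∀ a, δ a = c * γ a) (A : Finset (Fin (p + q))) : up δ A = c ^ A.card * up γ A := by
  induction A using Finset.induction_on_min with
  | empty => simp [up_empty]
  | insert m A hm ih =>
    have hmA : m ∉ A := fun h' => lt_irrefl _ (hm m h')
    rw [up_insert γ hm, up_insert δ hm, ih, Finset.card_insert_of_notMem hmA, h, pow_succ',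
      mul_assoc, mul_assoc, ← mul_assoc (γ m), ← ((hc (γ m)).pow_left _).eq, mul_assoc]

lemma up_conj {γ δ : Fin (p + q) → Cl p q} {T : (Cl p q)ˣ}
    (h : ∀ a, δ a = (↑T⁻¹ : Cl p q) * γ a * T) (A : Finset (Fin (p + q))) :
    up δ A = (↑T⁻¹ : Cl p q) * up γ A * T := by
  induction A using Finset.induction_on_min with
  | empty => simp [up_empty]
  | insert m A hm ih =>
    rw [up_insert γ hm, up_insert δ hm, ih, h]
    simp only [mul_assoc, Units.mul_inv_cancel_left]

/-! ### The top product -/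

/-- Each generator anticommutes with the `n - 1` other factors, an even number. -/
lemma CliffordRelations.commute_top {γ : Fin (p + q) → Cl p q} (hγ : CliffordRelations γ)
    (hn : Odd (p + q)) (a : Fin (p + q)) : Commute (γ a) (top γ) := by
  have h := hγ.mul_up a Finset.univ
  rw [Finset.card_erase_of_mem (Finset.mem_univ _), Finset.card_univ, Fintype.card_fin,
    (Nat.Odd.sub_odd hn odd_one).neg_one_pow, one_smul] at h
  exact h

lemma commute_up {γ : Fin (p + q) → Cl p q} {x : Cl p q} (h : ∀ a, Commute (γ a) x)
    (A : Finset (Fin (p + q))) : Commute (up γ A) x := by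
  refine Commute.list_prod_left _ _ fun y hy => ?_
  obtain ⟨a, -, rfl⟩ := List.mem_map.1 hy
  exact h a

lemma CliffordRelations.up_mul_self {γ : Fin (p + q) → Cl p q} (hγ : CliffordRelations γ)
    (A : Finset (Fin (p + q))) :
    up γ A * up γ A = ((-1 : ℝ) ^ A.card.choose 2 * ∏ a ∈ A, sgn p q a) • (1 : Cl p q) := by
  induction A using Finset.induction_on_min with
  | empty => simp [up_empty]
  | insert m A hm ih =>
    have hmA : m ∉ A := fun h' => lt_irrefl _ (hm m h')
    have hc := hγ.mul_up m A
    rw [Finset.erase_eq_of_notMem hmA] at hc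
    have hs : ((-1 : ℝ) ^ A.card) * ((-1 : ℝ) ^ A.card) = 1 := by
      rw [← mul_pow]; norm_num
    have hc' : up γ A * γ m = ((-1 : ℝ) ^ A.card) • (γ m * up γ A) := by
      rw [hc, smul_smul, hs, one_smul]
    -- Commuting `γ m` through `up γ A` produces `(-1)^|A|`, matching the increment `C(k+1, 2) =
    -- C(k, 2) + k` of the exponent.
    rw [up_insert γ hm, mul_assoc, ← mul_assoc (up γ A), hc', smul_mul_assoc, mul_assoc, ih,
      mul_smul_comm, ← mul_assoc, hγ.mul_self, Finset.card_insert_of_notMem hmA,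
      Finset.prod_insert hmA, smul_mul_smul_comm, mul_one, smul_smul, Nat.choose_succ_succ' _ 1,
      Nat.choose_one_right, pow_add]
    congr 1
    ring

lemma prod_sgn : ∏ a, sgn p q a = (-1 : ℝ) ^ q := by
  rw [Fin.prod_univ_add]
  simp [sgn]

lemma CliffordRelations.top_mul_top {γ : Fin (p + q) → Cl p q} (hγ : CliffordRelations γ) :
    top γ * top γ = ((-1 : ℝ) ^ ((p + q).choose 2 + q)) • (1 : Cl p q) := by
  rw [top, hγ.up_mul_self, prod_sgn, Finset.card_univ, Fintype.card_fin, pow_add]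

lemma even_choose_two_four_mul_add_one (k : ℕ) : Even ((4 * k + 1).choose 2) := by
  rw [Nat.choose_two_right, Nat.add_sub_cancel,
    show (4 * k + 1) * (4 * k) = (2 * ((4 * k + 1) * k)) * 2 by ring,
    Nat.mul_div_cancel _ two_pos]
  exact even_two_mul _

lemma odd_choose_two_four_mul_add_three (k : ℕ) : Odd ((4 * k + 3).choose 2) := by
  rw [Nat.choose_two_right, show 4 * k + 3 - 1 = 4 * k + 2 by omega,
    show (4 * k + 3) * (4 * k + 2) = (2 * (4 * k ^ 2 + 5 * k + 1) + 1) * 2 by ring,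
    Nat.mul_div_cancel _ two_pos]
  exact odd_two_mul_add_one _

/-- Here `n ≡ 1 + 2q` mod 4, so `C(n, 2)` and `q` have the same parity. -/
lemma even_choose_two_add {p q : ℕ} (h : (p : ℤ) - q ≡ 1 [ZMOD 4]) :
    Even ((p + q).choose 2 + q) := by
  have h' : ((p : ℤ) - q) % 4 = 1 := h
  rcases Nat.even_or_odd' q with ⟨j, hj | hj⟩
  · rw [show p + q = 4 * ((p + q) / 4) + 1 by omega]
    exact (even_choose_two_four_mul_add_one _).add ⟨j, by omega⟩
  · rw [show p + q = 4 * ((p + q) / 4) + 3 by omega]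
    exact (odd_choose_two_four_mul_add_three _).add_odd ⟨j, hj⟩

lemma odd_choose_two_add {p q : ℕ} (h : (p : ℤ) - q ≡ 3 [ZMOD 4]) :
    Odd ((p + q).choose 2 + q) := by
  have h' : ((p : ℤ) - q) % 4 = 3 := h
  rcases Nat.even_or_odd' q with ⟨j, hj | hj⟩
  · rw [show p + q = 4 * ((p + q) / 4) + 3 by omega]
    exact (odd_choose_two_four_mul_add_three _).add_even ⟨j, by omega⟩
  · rw [show p + q = 4 * ((p + q) / 4) + 1 by omega]
    exact (even_choose_two_four_mul_add_one _).add_odd ⟨j, hj⟩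

lemma CliffordRelations.top_mul_top_of_one {γ : Fin (p + q) → Cl p q} (hγ : CliffordRelations γ)
    (h : (p : ℤ) - q ≡ 1 [ZMOD 4]) : top γ * top γ = 1 := by
  rw [hγ.top_mul_top, (even_choose_two_add h).neg_one_pow, one_smul]

lemma CliffordRelations.top_mul_top_of_three {γ : Fin (p + q) → Cl p q}
    (hγ : CliffordRelations γ) (h : (p : ℤ) - q ≡ 3 [ZMOD 4]) : top γ * top γ = -1 := by
  rw [hγ.top_mul_top, (odd_choose_two_add h).neg_one_pow, neg_one_smul]

/-! ### The standard generators -/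

lemma cliffordRelations_gen : CliffordRelations (gen p q) := by
  intro a b
  rw [gen, gen, CliffordAlgebra.ι_mul_ι_add_swap, Algebra.algebraMap_eq_smul_one]
  congr 1
  simp only [QuadraticMap.polar, QuadraticMap.weightedSumSquares_apply, ← Finset.sum_sub_distrib,
    Pi.add_apply, smul_eq_mul]
  rw [Finset.sum_eq_single a]
  · rcases eq_or_ne a b with rfl | h
    · simp [eta]; ring
    · simp [eta, Matrix.diagonal_apply_ne _ h, Pi.single_eq_of_ne h]
  · intro i _ hi
    simp [Pi.single_eq_of_ne hi]
  · simp

lemma ι_eq_sum_gen (v : Fin (p + q) → ℝ) :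
    CliffordAlgebra.ι (QuadraticMap.weightedSumSquares ℝ (sgn p q)) v = ∑ a, v a • gen p q a := by
  conv_lhs => rw [pi_eq_sum_univ' v]
  rw [map_sum]
  refine Finset.sum_congr rfl fun a _ => ?_
  rw [map_smul, gen]

lemma span_up_gen : Submodule.span ℝ (Set.range (up (gen p q))) = ⊤ := by
  rw [eq_top_iff]
  rintro x -
  have hmul : ∀ (a : Fin (p + q)) (y), y ∈ Submodule.span ℝ (Set.range (up (gen p q))) →
      gen p q a * y ∈ Submodule.span ℝ (Set.range (up (gen p q))) := by
    intro a y hy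
    induction hy using Submodule.span_induction with
    | mem y hy =>
      obtain ⟨A, rfl⟩ := hy
      obtain ⟨s, -, H⟩ := exists_sign_mul_up a A
      rw [H _ cliffordRelations_gen]
      exact Submodule.smul_mem _ _ (Submodule.subset_span ⟨_, rfl⟩)
    | zero => simp
    | add y z _ _ hy hz => rw [mul_add]; exact add_mem hy hz
    | smul r y _ hy => rw [mul_smul_comm]; exact Submodule.smul_mem _ _ hy
  induction x using CliffordAlgebra.left_induction with
  | algebraMap r =>
    rw [Algebra.algebraMap_eq_smul_one, ← up_empty (gen p q)]
    exact Submodule.smul_mem _ _ (Submodule.subset_span ⟨_, rfl⟩)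
  | add x y hx hy => exact add_mem hx hy
  | ι_mul x m hx =>
    rw [ι_eq_sum_gen, Finset.sum_mul]
    refine Submodule.sum_mem _ fun a _ => ?_
    rw [smul_mul_assoc]
    exact Submodule.smul_mem _ _ (hmul a x hx)

lemma commute_of_commute_gen {x : Cl p q} (h : ∀ a, Commute (gen p q a) x) (y : Cl p q) :
    Commute x y := by
  have hy : y ∈ Submodule.span ℝ (Set.range (up (gen p q))) := by
    rw [span_up_gen]; trivial
  induction hy using Submodule.span_induction with
  | mem y hy =>
    obtain ⟨A, rfl⟩ := hy
    exact (commute_up h A).symm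
  | zero => exact Commute.zero_right x
  | add y z _ _ hy hz => exact hy.add_right hz
  | smul r y _ hy => exact hy.smul_right r

lemma commute_vol (hn : Odd (p + q)) (x : Cl p q) : Commute (vol p q) x :=
  commute_of_commute_gen (cliffordRelations_gen.commute_top hn) x

lemma involute_up_gen (A : Finset (Fin (p + q))) :
    CliffordAlgebra.involute (up (gen p q) A) = ((-1 : ℝ) ^ A.card) • up (gen p q) A := by
  induction A using Finset.induction_on_min with
  | empty => simp [up_empty]
  | insert m A hm ih =>
    have hmA : m ∉ A := fun h' => lt_irrefl _ (hm m h')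
    rw [up_insert _ hm, map_mul, ih, gen, CliffordAlgebra.involute_ι,
      Finset.card_insert_of_notMem hmA, pow_succ]
    simp

lemma involute_vol (hn : Odd (p + q)) :
    CliffordAlgebra.involute (vol p q) = -vol p q := by
  rw [vol, top, involute_up_gen, Finset.card_univ, Fintype.card_fin, hn.neg_one_pow, neg_one_smul]

/-- For odd `n` the grade involution fixes `e` and negates `e^{1…n}`, which separates the two
coefficients. -/
lemma smul_one_add_smul_vol_eq_zero (hn : Odd (p + q)) {r t : ℝ}
    (h : r • (1 : Cl p q) + t • vol p q = 0) : r = 0 ∧ t = 0 := by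
  have : Invertible (2 : ℝ) := invertibleOfNonzero two_ne_zero
  have h' := congrArg (CliffordAlgebra.involute) h
  rw [map_add, map_smul, map_smul, map_one, involute_vol hn, map_zero, smul_neg] at h'
  have h1 : (2 * r) • (1 : Cl p q) = 0 := by
    have := congrArg₂ (· + ·) h h'
    simp only [add_zero] at this
    rw [← this]; module
  have hr : r = 0 := by simpa using h1
  refine ⟨hr, ?_⟩
  rw [hr, zero_smul, zero_add] at h
  by_contra ht
  exact (cliffordRelations_gen.isUnit_up (p := p) (q := q) Finset.univ).ne_zero
    ((smul_eq_zero.1 h).resolve_left ht)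

/-! ### Averaging over even multi-indices -/

lemma even_card_symmDiff {α : Type*} [DecidableEq α] {A B : Finset α} (hA : Even A.card)
    (hB : Even B.card) : Even (A ∆ B).card := by
  have h1 := Finset.card_sdiff_add_card_inter A B
  have h2 := Finset.card_sdiff_add_card_inter B A
  have h3 : (A ∆ B).card = (A \ B).card + (B \ A).card :=
    Finset.card_union_of_disjoint disjoint_sdiff_sdiff
  rw [Finset.inter_comm] at h2
  rw [Nat.even_iff] at *
  omega

/-- Complementation exchanges even and odd subsets because `n` is odd. -/
lemma two_mul_card_even (hn : Odd (p + q)) :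
    2 * (Finset.univ.filter fun A : Finset (Fin (p + q)) => Even A.card).card = 2 ^ (p + q) := by
  have h1 : (Finset.univ.filter fun A : Finset (Fin (p + q)) => Even A.card).card =
      (Finset.univ.filter fun A : Finset (Fin (p + q)) => ¬ Even A.card).card := by
    refine Finset.card_nbij' compl compl ?_ ?_ ?_ ?_
    · intro A hA
      have := Finset.card_compl_add_card A
      simp only [Finset.coe_filter, Finset.mem_univ, true_and, Set.mem_ofPred_eq,
        Fintype.card_fin] at *
      grind
    · intro A hA
      have := Finset.card_compl_add_card A
      simp only [Finset.coe_filter, Finset.mem_univ, true_and, Set.mem_ofPred_eq,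
        Fintype.card_fin] at *
      grind
    · intro A _; simp
    · intro A _; simp
  have h2 := Finset.card_filter_add_card_filter_not (s := Finset.univ)
    (fun A : Finset (Fin (p + q)) => Even A.card)
  rw [← h1] at h2
  rw [two_mul, h2]
  simp

lemma inv_two_pow_mul_card_even (hn : Odd (p + q)) :
    (1 : ℝ) / 2 ^ (p + q - 1) *
      (Finset.univ.filter fun A : Finset (Fin (p + q)) => Even A.card).card = 1 := by
  have h := two_mul_card_even hn
  have hpos : 0 < p + q := hn.pos
  have h' := Nat.eq_of_mul_eq_mul_left two_pos (h.trans (mul_pow_sub_one hpos.ne' 2).symm)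
  rw [h']
  push_cast
  field_simp

/-- `H_Even` as a linear map. -/
def hEvenLin (β γ : Fin (p + q) → Cl p q) : Cl p q →ₗ[ℝ] Cl p q :=
  ((1 : ℝ) / 2 ^ (p + q - 1)) • ∑ A : Finset (Fin (p + q)) with Even A.card,
    LinearMap.mulRight ℝ (down γ A) ∘ₗ LinearMap.mulLeft ℝ (up β A)

lemma hEvenLin_apply (β γ : Fin (p + q) → Cl p q) (U : Cl p q) :
    hEvenLin β γ U = HEven β γ U := by
  simp [hEvenLin, HEven, LinearMap.sum_apply]

/-- `T` intertwines the even products of `β` and `γ`: `β^A T = T γ^A` for `|A|` even. -/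
def Intertwines (β γ : Fin (p + q) → Cl p q) (T : Cl p q) : Prop :=
  ∀ A : Finset (Fin (p + q)), Even A.card → up β A * T = T * up γ A

variable {β γ : Fin (p + q) → Cl p q}

lemma intertwines_hEven (hβ : CliffordRelations β) (hγ : CliffordRelations γ) (U : Cl p q) :
    Intertwines β γ (HEven β γ U) := by
  intro B hB
  have key : up β B * HEven β γ U * down γ B = HEven β γ U := by
    rw [HEven, mul_smul_comm, smul_mul_assoc, Finset.mul_sum, Finset.sum_mul]
    congr 1
    -- Conjugation by `β^B`, `γ_B` only permutes the summands, by `A ↦ B ∆ A`.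
    refine Finset.sum_nbij' (B ∆ ·) (B ∆ ·) ?_ ?_ ?_ ?_ ?_
    · intro A hA
      simp only [Finset.mem_filter, Finset.mem_univ, true_and] at hA ⊢
      exact even_card_symmDiff hB hA
    · intro A hA
      simp only [Finset.mem_filter, Finset.mem_univ, true_and] at hA ⊢
      exact even_card_symmDiff hB hA
    · intro A _; exact symmDiff_symmDiff_cancel_left _ _
    · intro A _; exact symmDiff_symmDiff_cancel_left _ _
    · intro A _
      obtain ⟨s, hs, H⟩ := exists_sign_up_mul_up B A
      calc up β B * (up β A * U * down γ A) * down γ B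
          = (up β B * up β A) * U * (down γ A * down γ B) := by simp only [mul_assoc]
        _ = up β (B ∆ A) * U * down γ (B ∆ A) := by
          -- The reordering sign is the same for `β` and for `γ`, so it appears squared.
          rw [H β hβ, hγ.down_mul_down hs (H γ hγ), smul_mul_assoc, smul_mul_smul_comm, hs,
            one_smul]
  calc up β B * HEven β γ U = up β B * HEven β γ U * (down γ B * up γ B) := by
        rw [hγ.down_mul_up, mul_one]
    _ = HEven β γ U * up γ B := by rw [← mul_assoc, key]

lemma hEven_conj (hβ : CliffordRelations β) (hγ : CliffordRelations γ) (U : Cl p q)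
    {B : Finset (Fin (p + q))} (hB : Even B.card) :
    HEven β γ (up β B * U * down γ B) = HEven β γ U := by
  rw [HEven, HEven]
  congr 1
  refine Finset.sum_nbij' (· ∆ B) (· ∆ B) ?_ ?_ ?_ ?_ ?_
  · intro A hA
    simp only [Finset.mem_filter, Finset.mem_univ, true_and] at hA ⊢
    exact even_card_symmDiff hA hB
  · intro A hA
    simp only [Finset.mem_filter, Finset.mem_univ, true_and] at hA ⊢
    exact even_card_symmDiff hA hB
  · intro A _; exact symmDiff_symmDiff_cancel_right _ _
  · intro A _; exact symmDiff_symmDiff_cancel_right _ _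
  · intro A _
    obtain ⟨s, hs, H⟩ := exists_sign_up_mul_up A B
    calc up β A * (up β B * U * down γ B) * down γ A
        = (up β A * up β B) * U * (down γ B * down γ A) := by simp only [mul_assoc]
      _ = up β (A ∆ B) * U * down γ (A ∆ B) := by
        rw [H β hβ, hγ.down_mul_down hs (H γ hγ), smul_mul_assoc, smul_mul_smul_comm, hs,
          one_smul]

lemma Intertwines.hEven_mul {T : Cl p q} (hT : Intertwines β γ T)
    (δ : Fin (p + q) → Cl p q) (V : Cl p q) : HEven β δ (T * V) = T * HEven γ δ V := by
  rw [HEven, HEven, mul_smul_comm, Finset.mul_sum]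
  congr 1
  refine Finset.sum_congr rfl fun A hA => ?_
  simp only [Finset.mem_filter, Finset.mem_univ, true_and] at hA
  rw [← mul_assoc, hT A hA]
  simp only [mul_assoc]

lemma hEven_self_one (hn : Odd (p + q)) (hγ : CliffordRelations γ) : HEven γ γ 1 = 1 := by
  rw [HEven, Finset.sum_congr rfl (fun A _ => by rw [mul_one, hγ.up_mul_down]), Finset.sum_const,
    ← Nat.cast_smul_eq_nsmul ℝ, smul_smul, inv_two_pow_mul_card_even hn, one_smul]

lemma Intertwines.hEven_eq (hn : Odd (p + q)) (hγ : CliffordRelations γ) {T : Cl p q}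
    (hT : Intertwines β γ T) : HEven β γ T = T := by
  have := hT.hEven_mul γ 1
  rwa [mul_one, hEven_self_one hn hγ, mul_one] at this

lemma Intertwines.central_mul {T z : Cl p q} (hT : Intertwines β γ T) (hz : ∀ x, Commute z x) :
    Intertwines β γ (z * T) := by
  intro A hA
  rw [← mul_assoc, ← (hz (up β A)).eq, mul_assoc, hT A hA, mul_assoc]

lemma hEven_central_mul {z : Cl p q} (hz : ∀ x, Commute z x) (U : Cl p q) :
    HEven β γ (z * U) = z * HEven β γ U := by
  rw [HEven, HEven, mul_smul_comm, Finset.mul_sum]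
  congr 1
  refine Finset.sum_congr rfl fun A hA => ?_
  rw [← mul_assoc, ← (hz (up β A)).eq]
  simp only [mul_assoc]

/-- With `a ∈ A` and `b ∉ A`, which exists since `|A|` is even and `n` is odd, conjugation by
`γ^{ab}` negates `γ^A` but leaves the average unchanged. -/
lemma hEven_self_up (hn : Odd (p + q)) (hγ : CliffordRelations γ) {A : Finset (Fin (p + q))}
    (hA : Even A.card) (hne : A.Nonempty) : HEven γ γ (up γ A) = 0 := by
  obtain ⟨a, ha⟩ := hne
  obtain ⟨b, hb⟩ : ∃ b, b ∉ A := by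
    by_contra! h
    rw [Finset.eq_univ_of_forall h, Finset.card_univ, Fintype.card_fin] at hA
    exact Nat.not_even_iff_odd.2 hn hA
  have hab : a ≠ b := fun h => hb (h ▸ ha)
  have hB : Even ({a, b} : Finset (Fin (p + q))).card := by
    rw [Finset.card_pair hab]; exact even_two
  have hsd : ({a} ∆ {b} : Finset (Fin (p + q))) = {a, b} := by
    ext x; simp only [Finset.mem_symmDiff, Finset.mem_singleton, Finset.mem_insert]; grind
  have ca : γ a * up γ A = -(up γ A * γ a) := by
    have h := hγ.mul_up a A
    rwa [Finset.card_erase_of_mem ha, (Nat.Even.sub_odd (Finset.card_pos.2 ⟨a, ha⟩) hA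
      odd_one).neg_one_pow, neg_one_smul] at h
  have cb : γ b * up γ A = up γ A * γ b := by
    have h := hγ.mul_up b A
    rwa [Finset.erase_eq_of_notMem hb, hA.neg_one_pow, one_smul] at h
  obtain ⟨s, hs, H⟩ := exists_sign_up_mul_up {a} {b}
  have hup : up γ {a, b} = s • (γ a * γ b) := by
    have := H γ hγ
    rw [up_singleton, up_singleton, hsd] at this
    rw [this, smul_smul, hs, one_smul]
  have hcomm : up γ {a, b} * up γ A = -(up γ A * up γ {a, b}) := by
    rw [hup, smul_mul_assoc, mul_assoc, cb, ← mul_assoc, ca, mul_smul_comm, neg_mul, smul_neg,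
      mul_assoc]
  have h := hEven_conj hγ hγ (up γ A) hB
  rw [hcomm, neg_mul, mul_assoc, hγ.up_mul_down, mul_one, ← hEvenLin_apply, ← hEvenLin_apply, map_neg] at h
  have h2 : (2 : ℝ) • hEvenLin γ γ (up γ A) = 0 := by
    rw [two_smul]; nth_rewrite 1 [← h]; exact neg_add_cancel _
  rw [← hEvenLin_apply]
  exact (smul_eq_zero.1 h2).resolve_left two_ne_zero

/-! ### Traces -/

/-- Left multiplication by `u` conjugates the operator to its negative. -/
lemma trace_mulRight_comp_mulLeft_eq_zero {x y u : Cl p q} (hu : IsUnit u)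
    (h : u * x = -(x * u)) :
    LinearMap.trace ℝ (Cl p q) (LinearMap.mulRight ℝ y ∘ₗ LinearMap.mulLeft ℝ x) = 0 := by
  obtain ⟨u, rfl⟩ := hu
  set M : Module.End ℝ (Cl p q) := LinearMap.mulRight ℝ y ∘ₗ LinearMap.mulLeft ℝ x with hM
  have h1 : M * LinearMap.mulLeft ℝ (u : Cl p q) =
      (-1 : ℝ) • (LinearMap.mulLeft ℝ (u : Cl p q) * M) := by
    ext z
    simp only [hM, Module.End.mul_apply, LinearMap.comp_apply, LinearMap.mulLeft_apply,
      LinearMap.mulRight_apply, LinearMap.smul_apply, neg_one_smul]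
    rw [← mul_assoc, ← mul_assoc, ← mul_assoc, h, neg_mul, neg_mul, neg_neg]
  have h2 : LinearMap.mulLeft ℝ (u : Cl p q) * LinearMap.mulLeft ℝ (↑u⁻¹ : Cl p q) = 1 := by
    ext z; simp
  have h3 : LinearMap.mulLeft ℝ (↑u⁻¹ : Cl p q) * LinearMap.mulLeft ℝ (u : Cl p q) = 1 := by
    ext z; simp
  have h4 : LinearMap.trace ℝ (Cl p q) M = -LinearMap.trace ℝ (Cl p q) M := by
    calc LinearMap.trace ℝ (Cl p q) M
        = LinearMap.trace ℝ (Cl p q)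
          ((M * LinearMap.mulLeft ℝ (u : Cl p q)) * LinearMap.mulLeft ℝ (↑u⁻¹ : Cl p q)) := by
          rw [mul_assoc, h2, mul_one]
      _ = -LinearMap.trace ℝ (Cl p q) M := by
        rw [h1, smul_mul_assoc, map_smul, LinearMap.trace_mul_comm, ← mul_assoc, h3, one_mul,
          neg_one_smul]
  exact self_eq_neg.1 h4

/-- Since `z` is central, `z β^A` still anticommutes with `β^a` for `a ∈ A`, so only the term `A =
∅` has a trace. -/
lemma trace_mulLeft_comp_hEvenLin (hβ : CliffordRelations β) {z : Cl p q}
    (hz : ∀ x, Commute z x) :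
    LinearMap.trace ℝ (Cl p q) (LinearMap.mulLeft ℝ z ∘ₗ hEvenLin β γ) =
      (1 : ℝ) / 2 ^ (p + q - 1) * LinearMap.trace ℝ (Cl p q) (LinearMap.mulLeft ℝ z) := by
  have h : LinearMap.mulLeft ℝ z ∘ₗ hEvenLin β γ = ((1 : ℝ) / 2 ^ (p + q - 1)) •
      ∑ A : Finset (Fin (p + q)) with Even A.card,
        LinearMap.mulRight ℝ (down γ A) ∘ₗ LinearMap.mulLeft ℝ (z * up β A) := by
    ext x
    simp only [hEvenLin, LinearMap.comp_apply, LinearMap.smul_apply, LinearMap.sum_apply,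
      LinearMap.mulLeft_apply, LinearMap.mulRight_apply, mul_smul_comm, Finset.mul_sum, mul_assoc]
  rw [h, map_smul, map_sum, smul_eq_mul, Finset.sum_eq_single ∅]
  · rw [up_empty, down_empty, mul_one]
    congr 2
    ext x; simp
  · intro A hA hne
    simp only [Finset.mem_filter, Finset.mem_univ, true_and] at hA
    obtain ⟨a, ha⟩ := Finset.nonempty_iff_ne_empty.2 hne
    have ca : β a * up β A = -(up β A * β a) := by
      have h := hβ.mul_up a A
      rwa [Finset.card_erase_of_mem ha, (Nat.Even.sub_odd (Finset.card_pos.2 ⟨a, ha⟩) hA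
        odd_one).neg_one_pow, neg_one_smul] at h
    refine trace_mulRight_comp_mulLeft_eq_zero (u := β a) ?_ ?_
    · rw [← up_singleton β a]; exact hβ.isUnit_up _
    · rw [← mul_assoc, ← (hz (β a)).eq, mul_assoc, ca, mul_neg, mul_assoc]
  · simp

/-- The grade involution conjugates multiplication by `e^{1…n}` to its negative. -/
lemma trace_mulLeft_vol (hn : Odd (p + q)) :
    LinearMap.trace ℝ (Cl p q) (LinearMap.mulLeft ℝ (vol p q)) = 0 := by
  let e : Cl p q ≃ₗ[ℝ] Cl p q := CliffordAlgebra.involuteEquiv.toLinearEquiv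
  have he : e.conj (LinearMap.mulLeft ℝ (vol p q)) = -LinearMap.mulLeft ℝ (vol p q) := by
    refine LinearMap.ext fun x => ?_
    obtain ⟨y, rfl⟩ := e.surjective x
    rw [LinearEquiv.conj_apply_apply, e.symm_apply_apply, LinearMap.neg_apply,
      LinearMap.mulLeft_apply, LinearMap.mulLeft_apply, ← neg_mul]
    exact (map_mul CliffordAlgebra.involute _ _).trans (by rw [involute_vol hn]; rfl)
  have h := LinearMap.trace_conj' (LinearMap.mulLeft ℝ (vol p q)) e
  rw [he, map_neg] at h
  exact self_eq_neg.1 h.symm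

/-! ### The basis attached to a Clifford system -/

lemma not_even_card_compl (hn : Odd (p + q)) {A : Finset (Fin (p + q))} (hA : Even A.card) :
    ¬ Even Aᶜ.card := by
  have := Finset.card_compl_add_card A
  rw [Fintype.card_fin] at this
  grind

lemma even_card_compl (hn : Odd (p + q)) {A : Finset (Fin (p + q))} (hA : ¬ Even A.card) :
    Even Aᶜ.card := by
  have := Finset.card_compl_add_card A
  rw [Fintype.card_fin] at this
  grind

/-- The even products `γ^A` together with their multiples by `e^{1…n}`. -/
def evenFamily (γ : Fin (p + q) → Cl p q) (A : Finset (Fin (p + q))) : Cl p q :=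
  if Even A.card then up γ A else vol p q * up γ Aᶜ

lemma evenFamily_of_even {A : Finset (Fin (p + q))} (hA : Even A.card) :
    evenFamily γ A = up γ A := if_pos hA

lemma evenFamily_of_not_even {A : Finset (Fin (p + q))} (hA : ¬ Even A.card) :
    evenFamily γ A = vol p q * up γ Aᶜ := if_neg hA

lemma hEven_self_up_mul_down (hn : Odd (p + q)) (hγ : CliffordRelations γ)
    {A B : Finset (Fin (p + q))} (hA : Even A.card) (hB : Even B.card) :
    HEven γ γ (up γ A * down γ B) = if A = B then 1 else 0 := by
  split_ifs with h
  · rw [h, hγ.up_mul_down, hEven_self_one hn hγ]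
  · obtain ⟨s, hs, H⟩ := exists_sign_up_mul_up (A ∆ B) B
    have h1 := H γ hγ
    rw [symmDiff_symmDiff_cancel_right] at h1
    have h2 : up γ A * down γ B = s • up γ (A ∆ B) := by
      calc up γ A * down γ B = s • (s • up γ A) * down γ B := by rw [smul_smul, hs, one_smul]
        _ = s • up γ (A ∆ B) := by
          rw [← h1, smul_mul_assoc, mul_assoc, hγ.up_mul_down, mul_one]
    rw [h2, ← hEvenLin_apply, map_smul, hEvenLin_apply,
      hEven_self_up hn hγ (even_card_symmDiff hA hB), smul_zero]
    rw [Finset.nonempty_iff_ne_empty, ← Finset.bot_eq_empty, Ne, symmDiff_eq_bot]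
    exact h

lemma hEven_self_evenFamily_mul_down (hn : Odd (p + q)) (hγ : CliffordRelations γ)
    (A : Finset (Fin (p + q))) {B : Finset (Fin (p + q))} (hB : Even B.card) :
    HEven γ γ (evenFamily γ A * down γ B) =
      (if A = B then 1 else 0) + (if A = Bᶜ then vol p q else 0) := by
  by_cases hA : Even A.card
  · rw [evenFamily_of_even hA, hEven_self_up_mul_down hn hγ hA hB, if_neg (c := A = Bᶜ), add_zero]
    rintro rfl
    exact not_even_card_compl hn hB hA
  · rw [evenFamily_of_not_even hA, mul_assoc, hEven_central_mul (commute_vol hn),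
      hEven_self_up_mul_down hn hγ (even_card_compl hn hA) hB, if_neg (c := A = B), zero_add]
    · simp only [compl_eq_comm (x := A), eq_comm (a := A), mul_ite, mul_one, mul_zero]
    · rintro rfl
      exact hA hB

/-- A coefficient formula: one average reads off the coefficients at `B` and at `Bᶜ` together, to be
separated by the independence of `e` and `e^{1…n}`. -/
lemma hEven_self_sum_evenFamily_mul_down (hn : Odd (p + q)) (hγ : CliffordRelations γ)
    (t : Finset (Fin (p + q)) → ℝ) {B : Finset (Fin (p + q))} (hB : Even B.card) :
    HEven γ γ ((∑ A, t A • evenFamily γ A) * down γ B) = t B • 1 + t Bᶜ • vol p q := by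
  rw [Finset.sum_mul, ← hEvenLin_apply, map_sum]
  simp only [smul_mul_assoc, map_smul, hEvenLin_apply,
    hEven_self_evenFamily_mul_down hn hγ _ hB, smul_add, Finset.sum_add_distrib, smul_ite,
    smul_zero, Finset.sum_ite_eq', Finset.mem_univ, if_true]

lemma eq_zero_of_hEven_self_sum (hn : Odd (p + q)) (hγ : CliffordRelations γ)
    {t : Finset (Fin (p + q)) → ℝ}
    (h : ∀ B, Even B.card → HEven γ γ ((∑ A, t A • evenFamily γ A) * down γ B) = 0)
    (A : Finset (Fin (p + q))) : t A = 0 := by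
  by_cases hA : Even A.card
  · have := h A hA
    rw [hEven_self_sum_evenFamily_mul_down hn hγ t hA] at this
    exact (smul_one_add_smul_vol_eq_zero hn this).1
  · have hA' := even_card_compl hn hA
    have := h _ hA'
    rw [hEven_self_sum_evenFamily_mul_down hn hγ t hA', compl_compl] at this
    exact (smul_one_add_smul_vol_eq_zero hn this).2

lemma linearIndependent_evenFamily (hn : Odd (p + q)) (hγ : CliffordRelations γ) :
    LinearIndependent ℝ (evenFamily γ) := by
  rw [Fintype.linearIndependent_iff]
  intro t ht
  refine eq_zero_of_hEven_self_sum hn hγ fun B _ => ?_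
  rw [ht, zero_mul, ← hEvenLin_apply, map_zero]

/-- When the top product is `± e^{1…n}`, the odd products are `± e^{1…n} γ^{Aᶜ}`, so `up γ` is
`evenFamily γ` up to signs. -/
lemma linearIndependent_up (hn : Odd (p + q)) (hγ : CliffordRelations γ)
    (h : top γ = vol p q ∨ top γ = -vol p q) : LinearIndependent ℝ (up γ) := by
  have hw : ∀ A, ∃ w : ℝˣ, up γ A = w • evenFamily γ A := by
    intro A
    by_cases hA : Even A.card
    · exact ⟨1, by rw [evenFamily_of_even hA, one_smul]⟩
    · obtain ⟨s, hs, H⟩ := exists_sign_top_mul_up_compl A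
      rw [evenFamily_of_not_even hA, H γ hγ]
      rcases h with h | h
      · exact ⟨⟨s, s, hs, hs⟩, by rw [h, Units.smul_def]⟩
      · exact ⟨⟨-s, -s, by simpa using hs, by simpa using hs⟩, by
          rw [h, Units.smul_def, neg_mul, smul_neg, neg_smul]⟩
  choose w hw using hw
  have : up γ = w • evenFamily γ := funext hw
  rw [this]
  exact (linearIndependent_evenFamily hn hγ).units_smul w

instance : Module.Finite ℝ (Cl p q) :=
  ⟨⟨(Set.finite_range (up (gen p q))).toFinset, by
    rw [Set.Finite.coe_toFinset, span_up_gen]⟩⟩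

lemma finrank_cl (hn : Odd (p + q)) : Module.finrank ℝ (Cl p q) = 2 ^ (p + q) := by
  have b := Module.Basis.mk (linearIndependent_up hn cliffordRelations_gen (Or.inl rfl))
    span_up_gen.ge
  rw [Module.finrank_eq_card_basis b, Fintype.card_finset, Fintype.card_fin]

lemma generatesBasis_of_top_eq (hn : Odd (p + q)) (hγ : CliffordRelations γ)
    (h : top γ = vol p q ∨ top γ = -vol p q) : GeneratesBasis γ :=
  have hli := linearIndependent_up hn hγ h
  ⟨hli, hli.span_eq_top_of_card_eq_finrank' (by
    rw [finrank_cl hn, Fintype.card_finset, Fintype.card_fin])⟩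

lemma not_generatesBasis_of_top_eq (hn : Odd (p + q)) (h : top γ = 1 ∨ top γ = -1) :
    ¬ GeneratesBasis γ := by
  rintro ⟨hli, -⟩
  -- The dependence is between `γ^{1…n}` and `γ^∅ = e`, whose indices differ because `n > 0`.
  have hne : (Finset.univ : Finset (Fin (p + q))) ≠ ∅ := by
    intro h0
    have := congrArg Finset.card h0
    rw [Finset.card_univ, Fintype.card_fin, Finset.card_empty] at this
    exact hn.pos.ne' this
  have hpair : LinearIndependent ℝ ![top γ, 1] := by
    convert hli.comp ![Finset.univ, ∅] (by
      intro i j hij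
      fin_cases i <;> fin_cases j <;> simp_all [eq_comm]) using 1
    ext i
    fin_cases i
    · rfl
    · exact (up_empty γ).symm
  have h2 := LinearIndependent.pair_iff.1 hpair
  rcases h with h | h
  · have := h2 1 (-1) (by rw [h]; simp)
    exact one_ne_zero this.1
  · have := h2 1 1 (by rw [h]; simp)
    exact one_ne_zero this.1

lemma span_evenFamily (hn : Odd (p + q)) (hγ : CliffordRelations γ) :
    Submodule.span ℝ (Set.range (evenFamily γ)) = ⊤ :=
  (linearIndependent_evenFamily hn hγ).span_eq_top_of_card_eq_finrank' (by
    rw [finrank_cl hn, Fintype.card_finset, Fintype.card_fin])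

/-- Averaging products is nondegenerate. -/
lemma exists_hEven_self_mul_ne_zero (hn : Odd (p + q)) (hγ : CliffordRelations γ) {T : Cl p q}
    (hT : T ≠ 0) : ∃ V, HEven γ γ (T * V) ≠ 0 := by
  by_contra! h
  have hmem : T ∈ Submodule.span ℝ (Set.range (evenFamily γ)) := by
    rw [span_evenFamily hn hγ]; trivial
  obtain ⟨t, rfl⟩ := (Submodule.mem_span_range_iff_exists_fun ℝ).1 hmem
  refine hT (Finset.sum_eq_zero fun A _ => ?_)
  -- The test elements `V = γ_B` with `|B|` even already detect every coefficient of `T`.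
  rw [eq_zero_of_hEven_self_sum hn hγ (fun B _ => h _) A, zero_smul]

/-! ### The space of intertwiners -/

lemma trace_mulLeft_one (hn : Odd (p + q)) :
    LinearMap.trace ℝ (Cl p q) (LinearMap.mulLeft ℝ (1 : Cl p q)) = 2 ^ (p + q) := by
  rw [LinearMap.mulLeft_one, LinearMap.trace_id, finrank_cl hn]
  push_cast
  rfl

lemma trace_hEvenLin (hn : Odd (p + q)) (hβ : CliffordRelations β) :
    LinearMap.trace ℝ (Cl p q) (hEvenLin β γ) = 2 := by
  have h := trace_mulLeft_comp_hEvenLin (γ := γ) hβ (Commute.one_left (M := Cl p q))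
  rw [trace_mulLeft_one hn, LinearMap.mulLeft_one, LinearMap.id_comp] at h
  rw [h, ← mul_pow_sub_one hn.pos.ne' (2 : ℝ)]
  field_simp

/-- The submodule of intertwiners. -/
def intertwiners (β γ : Fin (p + q) → Cl p q) : Submodule ℝ (Cl p q) where
  carrier := {T | Intertwines β γ T}
  add_mem' hS hT A hA := by rw [mul_add, add_mul, hS A hA, hT A hA]
  zero_mem' A _ := by rw [mul_zero, zero_mul]
  smul_mem' r T hT A hA := by rw [mul_smul_comm, smul_mul_assoc, hT A hA]

/-- The rank of a projection is its trace. -/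
lemma finrank_intertwiners (hn : Odd (p + q)) (hβ : CliffordRelations β)
    (hγ : CliffordRelations γ) : Module.finrank ℝ (intertwiners β γ) = 2 := by
  have hp : LinearMap.IsProj (intertwiners β γ) (hEvenLin β γ) :=
    ⟨fun U => by rw [hEvenLin_apply]; exact intertwines_hEven hβ hγ U,
      fun T hT => by rw [hEvenLin_apply]; exact Intertwines.hEven_eq hn hγ hT⟩
  have h := hp.trace
  rw [trace_hEvenLin hn hβ] at h
  exact_mod_cast h.symm

/-- Elements commuting with all even products are combinations of `e` and `e^{1…n}`. -/
lemma Intertwines.exists_eq (hn : Odd (p + q)) (hγ : CliffordRelations γ) {x : Cl p q}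
    (hx : Intertwines γ γ x) : ∃ r t : ℝ, r • 1 + t • vol p q = x := by
  have hle : Submodule.span ℝ {1, vol p q} ≤ intertwiners γ γ := by
    rw [Submodule.span_le]
    rintro y (rfl | rfl)
    · intro A _; rw [mul_one, one_mul]
    · intro A _; exact ((commute_vol hn _).eq).symm
  have hli : LinearIndependent ℝ ![1, vol p q] :=
    LinearIndependent.pair_iff.2 fun r t h => smul_one_add_smul_vol_eq_zero hn h
  have hfr : Module.finrank ℝ (Submodule.span ℝ {1, vol p q}) = 2 := by
    have := finrank_span_eq_card hli
    rwa [Matrix.range_cons_cons_empty] at this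
  have heq := Submodule.eq_of_le_of_finrank_eq hle
    (hfr.trans (finrank_intertwiners hn hγ hγ).symm)
  have hx' : x ∈ Submodule.span ℝ {1, vol p q} := by rw [heq]; exact hx
  exact Submodule.mem_span_pair.1 hx'

lemma commute_of_intertwines (hn : Odd (p + q)) (hγ : CliffordRelations γ) {x : Cl p q}
    (hx : Intertwines γ γ x) (y : Cl p q) : Commute x y := by
  obtain ⟨r, t, rfl⟩ := hx.exists_eq hn hγ
  exact ((Commute.one_left y).smul_left r).add_left ((commute_vol hn y).smul_left t)

lemma exists_top_eq (hn : Odd (p + q)) (hγ : CliffordRelations γ) :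
    ∃ r t : ℝ, r • 1 + t • vol p q = top γ :=
  Intertwines.exists_eq hn hγ fun A _ => commute_up (hγ.commute_top hn) A

lemma commute_top (hn : Odd (p + q)) (hγ : CliffordRelations γ) (x : Cl p q) :
    Commute (top γ) x :=
  commute_of_intertwines hn hγ (fun A _ => commute_up (hγ.commute_top hn) A) x

lemma sq_add_smul_vol (r t : ℝ) :
    (r • 1 + t • vol p q) * (r • 1 + t • vol p q) =
      (r * r) • (1 : Cl p q) + (2 * (r * t)) • vol p q + (t * t) • (vol p q * vol p q) := by
  simp only [add_mul, mul_add, smul_mul_smul_comm, one_mul, mul_one]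
  module

lemma vol_mul_vol_of_one (h : (p : ℤ) - q ≡ 1 [ZMOD 4]) : vol p q * vol p q = 1 :=
  cliffordRelations_gen.top_mul_top_of_one h

lemma vol_mul_vol_of_three (h : (p : ℤ) - q ≡ 3 [ZMOD 4]) : vol p q * vol p q = -1 :=
  cliffordRelations_gen.top_mul_top_of_three h

lemma top_eq_of_one (hn : Odd (p + q)) (h : (p : ℤ) - q ≡ 1 [ZMOD 4])
    (hγ : CliffordRelations γ) :
    (top γ = vol p q ∨ top γ = -vol p q) ∨ (top γ = 1 ∨ top γ = -1) := by
  obtain ⟨r, t, hrt⟩ := exists_top_eq hn hγ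
  have h2 := hγ.top_mul_top_of_one h
  rw [← hrt, sq_add_smul_vol, vol_mul_vol_of_one h] at h2
  obtain ⟨h3, h4⟩ := smul_one_add_smul_vol_eq_zero (r := r * r + t * t - 1) (t := 2 * (r * t)) hn
    (by rw [← sub_eq_zero] at h2; rw [← h2]; module)
  have h5 : r = 0 ∨ t = 0 := by simpa using h4
  rcases h5 with rfl | rfl
  · left
    have : t = 1 ∨ t = -1 := by
      rw [← mul_self_eq_one_iff]; linarith
    rcases this with rfl | rfl
    · left; rw [← hrt]; simp
    · right; rw [← hrt]; simp
  · right
    have : r = 1 ∨ r = -1 := by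
      rw [← mul_self_eq_one_iff]; linarith
    rcases this with rfl | rfl
    · left; rw [← hrt]; simp
    · right; rw [← hrt]; simp

lemma top_eq_of_three (hn : Odd (p + q)) (h : (p : ℤ) - q ≡ 3 [ZMOD 4])
    (hγ : CliffordRelations γ) : top γ = vol p q ∨ top γ = -vol p q := by
  obtain ⟨r, t, hrt⟩ := exists_top_eq hn hγ
  have h2 := hγ.top_mul_top_of_three h
  rw [← hrt, sq_add_smul_vol, vol_mul_vol_of_three h] at h2
  obtain ⟨h3, h4⟩ := smul_one_add_smul_vol_eq_zero (r := r * r - t * t + 1) (t := 2 * (r * t)) hn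
    (by rw [← sub_eq_zero] at h2; rw [← h2]; module)
  have h5 : r = 0 ∨ t = 0 := by simpa using h4
  rcases h5 with rfl | rfl
  · have : t = 1 ∨ t = -1 := by
      rw [← mul_self_eq_one_iff]; linarith
    rcases this with rfl | rfl
    · left; rw [← hrt]; simp
    · right; rw [← hrt]; simp
  -- Here `t = 0` would force `r² = -1`.
  · nlinarith [mul_self_nonneg r]

/-! ### Invertible intertwiners -/

lemma isUnit_of_mul_eq_one {T X : Cl p q} (h : T * X = 1) : IsUnit T := by
  have : IsNoetherianRing (Cl p q) := IsNoetherianRing.of_finite ℝ _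
  exact IsUnit.of_mul_eq_one X h

/-- With `X = HEven γ β V` one has `T X = HEven β β (T V)`, which intertwines `β` with itself;
nondegeneracy supplies a suitable `V`. -/
lemma Intertwines.exists_mul_ne_zero (hn : Odd (p + q)) (hβ : CliffordRelations β)
    {T : Cl p q} (hT : Intertwines β γ T) (h0 : T ≠ 0) :
    ∃ X, T * X ≠ 0 ∧ ∃ r t : ℝ, r • 1 + t • vol p q = T * X := by
  obtain ⟨V, hV⟩ := exists_hEven_self_mul_ne_zero hn hβ h0
  refine ⟨HEven γ β V, ?_, ?_⟩
  · rwa [← hT.hEven_mul]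
  · rw [← hT.hEven_mul]
    exact (intertwines_hEven hβ hβ _).exists_eq hn hβ

lemma Intertwines.isUnit_of_three (hn : Odd (p + q)) (h : (p : ℤ) - q ≡ 3 [ZMOD 4])
    (hβ : CliffordRelations β) {T : Cl p q} (hT : Intertwines β γ T) (h0 : T ≠ 0) :
    IsUnit T := by
  obtain ⟨X, hX, r, t, hrt⟩ := hT.exists_mul_ne_zero hn hβ h0
  have hN : r * r + t * t ≠ 0 := by
    intro hN
    have hr : r = 0 := mul_self_eq_zero.1 (by nlinarith [mul_self_nonneg r, mul_self_nonneg t])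
    have ht : t = 0 := mul_self_eq_zero.1 (by nlinarith [mul_self_nonneg r, mul_self_nonneg t])
    rw [hr, ht, zero_smul, zero_smul, add_zero] at hrt
    exact hX hrt.symm
  have hmul : (r • 1 + t • vol p q) * (r • 1 - t • vol p q) = (r * r + t * t) • (1 : Cl p q) := by
    simp only [add_mul, mul_sub, smul_mul_smul_comm, one_mul, mul_one, vol_mul_vol_of_three h]
    module
  refine isUnit_of_mul_eq_one (X := X * ((r * r + t * t)⁻¹ • (r • 1 - t • vol p q))) ?_
  rw [← mul_assoc, ← hrt, mul_smul_comm, hmul, smul_smul, inv_mul_cancel₀ hN, one_smul]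

/-- The element `(e + ε e^{1…n}) / 2`, a central idempotent if `ε = ±1` and `(e^{1…n})² = e`. -/
def half (p q : ℕ) (ε : ℝ) : Cl p q := (1 / 2 : ℝ) • (1 + ε • vol p q)

lemma commute_half (hn : Odd (p + q)) (ε : ℝ) (x : Cl p q) : Commute (half p q ε) x :=
  ((Commute.one_left x).add_left ((commute_vol hn x).smul_left ε)).smul_left _

lemma half_mul (h : (p : ℤ) - q ≡ 1 [ZMOD 4]) {ε : ℝ} (hε : ε * ε = 1) (r t : ℝ) :
    half p q ε * (r • 1 + t • vol p q) = (r + ε * t) • half p q ε := by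
  simp only [half, smul_mul_assoc, add_mul, mul_add, one_mul, mul_one, mul_smul_comm,
    vol_mul_vol_of_one h]
  rcases mul_self_eq_one_iff.1 hε with rfl | rfl <;> module

lemma half_add_half : half p q 1 + half p q (-1) = 1 := by
  simp only [half]; module

lemma half_mul_half (h : (p : ℤ) - q ≡ 1 [ZMOD 4]) {ε : ℝ} (hε : ε * ε = 1) :
    half p q ε * half p q ε = half p q ε := by
  -- These coefficients make the second factor `half p q ε` itself, with `r + ε t = 1`.
  have := half_mul (p := p) (q := q) h hε (1 / 2) (1 / 2 * ε)
  rw [show (1 / 2 : ℝ) + ε * (1 / 2 * ε) = 1 by linear_combination hε / 2, one_smul] at this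
  nth_rewrite 3 [← this]
  rw [half, smul_add, smul_smul]

lemma Intertwines.exists_half_mul_eq (hn : Odd (p + q)) (h : (p : ℤ) - q ≡ 1 [ZMOD 4])
    (hβ : CliffordRelations β) {T : Cl p q} (hT : Intertwines β γ T) {ε : ℝ} (hε : ε * ε = 1)
    (h0 : half p q ε * T ≠ 0) : ∃ X, half p q ε * T * X = half p q ε := by
  obtain ⟨X, hX, r, t, hrt⟩ :=
    (hT.central_mul (commute_half hn ε)).exists_mul_ne_zero hn hβ h0
  have h1 : half p q ε * T * X = (r + ε * t) • half p q ε := by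
    rw [← half_mul h hε, hrt, ← mul_assoc, ← mul_assoc, half_mul_half h hε]
  have h2 : r + ε * t ≠ 0 := by
    intro h2
    rw [h2, zero_smul] at h1
    exact hX h1
  exact ⟨(r + ε * t)⁻¹ • X, by rw [mul_smul_comm, h1, smul_smul, inv_mul_cancel₀ h2, one_smul]⟩

lemma Intertwines.isUnit_of_one (hn : Odd (p + q)) (h : (p : ℤ) - q ≡ 1 [ZMOD 4])
    (hβ : CliffordRelations β) {T : Cl p q} (hT : Intertwines β γ T)
    (h1 : half p q 1 * T ≠ 0) (h2 : half p q (-1) * T ≠ 0) : IsUnit T := by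
  obtain ⟨X, hX⟩ := hT.exists_half_mul_eq hn h hβ (by norm_num) h1
  obtain ⟨Y, hY⟩ := hT.exists_half_mul_eq hn h hβ (by norm_num) h2
  refine isUnit_of_mul_eq_one (X := half p q 1 * X + half p q (-1) * Y) ?_
  rw [mul_add, ← mul_assoc, ← mul_assoc, ← (commute_half hn _ T).eq, ← (commute_half hn _ T).eq,
    hX, hY, half_add_half]

lemma trace_mulLeft_half (hn : Odd (p + q)) (ε : ℝ) :
    LinearMap.trace ℝ (Cl p q) (LinearMap.mulLeft ℝ (half p q ε)) ≠ 0 := by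
  have : LinearMap.mulLeft ℝ (half p q ε) =
      (1 / 2 : ℝ) • (LinearMap.mulLeft ℝ (1 : Cl p q) + ε • LinearMap.mulLeft ℝ (vol p q)) := by
    ext x; simp [half, add_mul]
  rw [this, map_smul, map_add, map_smul, trace_mulLeft_vol hn, trace_mulLeft_one hn]
  simp

/-- Otherwise `z · HEven` would vanish on the even products, hence, commuting with `e^{1…n}`, on the
whole basis `evenFamily γ`, contradicting its nonzero trace. -/
lemma exists_mul_hEven_up_ne_zero (hn : Odd (p + q)) (hβ : CliffordRelations β)
    (hγ : CliffordRelations γ) {z : Cl p q} (hz : ∀ x, Commute z x)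
    (htr : LinearMap.trace ℝ (Cl p q) (LinearMap.mulLeft ℝ z) ≠ 0) :
    ∃ A : Finset (Fin (p + q)), Even A.card ∧ z * HEven β γ (up γ A) ≠ 0 := by
  by_contra! h
  have h0 : LinearMap.mulLeft ℝ z ∘ₗ hEvenLin β γ = 0 := by
    refine LinearMap.ext_on (span_evenFamily hn hγ) ?_
    rintro _ ⟨A, rfl⟩
    rw [LinearMap.comp_apply, hEvenLin_apply, LinearMap.mulLeft_apply, LinearMap.zero_apply]
    by_cases hA : Even A.card
    · rw [evenFamily_of_even hA, h A hA]
    · rw [evenFamily_of_not_even hA, hEven_central_mul (commute_vol hn), ← mul_assoc,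
        ← (commute_vol hn z).eq, mul_assoc, h _ (even_card_compl hn hA), mul_zero]
  have h1 := trace_mulLeft_comp_hEvenLin (γ := γ) hβ hz
  rw [h0, map_zero] at h1
  exact mul_ne_zero (by positivity) htr h1.symm

lemma exists_hEven_up_ne_zero (hn : Odd (p + q)) (hβ : CliffordRelations β)
    (hγ : CliffordRelations γ) :
    ∃ A : Finset (Fin (p + q)), Even A.card ∧ HEven β γ (up γ A) ≠ 0 := by
  obtain ⟨A, hA, h⟩ := exists_mul_hEven_up_ne_zero hn hβ hγ (Commute.one_left (M := Cl p q))
    (by rw [trace_mulLeft_one hn]; positivity)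
  exact ⟨A, hA, by rwa [one_mul] at h⟩

lemma exists_isUnit_hEven_add (hn : Odd (p + q)) (h : (p : ℤ) - q ≡ 1 [ZMOD 4])
    (hβ : CliffordRelations β) (hγ : CliffordRelations γ) :
    ∃ A B : Finset (Fin (p + q)), Even A.card ∧ Even B.card ∧
      IsUnit (HEven β γ (up γ A + up γ B)) := by
  obtain ⟨A, hA, hA0⟩ := exists_mul_hEven_up_ne_zero hn hβ hγ (commute_half hn 1)
    (trace_mulLeft_half hn 1)
  obtain ⟨B, hB, hB0⟩ := exists_mul_hEven_up_ne_zero hn hβ hγ (commute_half hn (-1))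
    (trace_mulLeft_half hn (-1))
  have hadd : ∀ A B, HEven β γ (up γ A + up γ B) = HEven β γ (up γ A) + HEven β γ (up γ B) := by
    intro A B
    rw [← hEvenLin_apply, map_add, hEvenLin_apply, hEvenLin_apply]
  have hself : ∀ {x : Cl p q}, x ≠ 0 → x + x ≠ 0 := by
    intro x hx h2
    rw [← two_smul ℝ] at h2
    exact hx ((smul_eq_zero.1 h2).resolve_left two_ne_zero)
  -- If one of the two averages survives both idempotents, it is used twice. Otherwise each is
  -- killed by exactly one idempotent, so nothing cancels in their sum.
  by_cases hA1 : half p q (-1) * HEven β γ (up γ A) = 0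
  · by_cases hB1 : half p q 1 * HEven β γ (up γ B) = 0
    · refine ⟨A, B, hA, hB, (intertwines_hEven hβ hγ _).isUnit_of_one hn h hβ ?_ ?_⟩
      · rwa [hadd, mul_add, hB1, add_zero]
      · rwa [hadd, mul_add, hA1, zero_add]
    · refine ⟨B, B, hB, hB, (intertwines_hEven hβ hγ _).isUnit_of_one hn h hβ ?_ ?_⟩
      · rw [hadd, mul_add]; exact hself hB1
      · rw [hadd, mul_add]; exact hself hB0
  · refine ⟨A, A, hA, hA, (intertwines_hEven hβ hγ _).isUnit_of_one hn h hβ ?_ ?_⟩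
    · rw [hadd, mul_add]; exact hself hA0
    · rw [hadd, mul_add]; exact hself hA1

/-! ### The relation `γ^a = c T⁻¹ β^a T` -/

lemma Intertwines.connects (hn : Odd (p + q)) (hβ : CliffordRelations β)
    (hγ : CliffordRelations γ) {T : (Cl p q)ˣ} (hT : Intertwines β γ (T : Cl p q)) {c : Cl p q}
    (hc : c * c = 1) (h : top β = c * top γ) : Connects c β γ T := by
  intro a
  obtain ⟨s, -, H⟩ := exists_sign_top_mul_up_compl {a}
  have hev : Even ({a}ᶜ : Finset (Fin (p + q))).card :=
    even_card_compl hn (by rw [Finset.card_singleton]; decide)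
  have hβa := H β hβ
  have hγa := H γ hγ
  rw [up_singleton] at hβa hγa
  rw [hβa, hγa, mul_smul_comm, smul_mul_assoc, mul_smul_comm, ← mul_assoc (↑T⁻¹ : Cl p q),
    ← (commute_top hn hβ (↑T⁻¹ : Cl p q)).eq, mul_assoc (top β), mul_assoc (top β), mul_assoc,
    hT _ hev, Units.inv_mul_cancel_left, h, ← mul_assoc, ← mul_assoc, hc, one_mul]

lemma pow_eq_self_of_odd {M : Type*} [Monoid M] {c : M} {n : ℕ} (hn : Odd n) (hc : c * c = 1) :
    c ^ n = c := by
  obtain ⟨k, rfl⟩ := hn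
  rw [pow_succ, pow_mul, pow_two, hc, one_pow, one_mul]

lemma Connects.top_eq (hn : Odd (p + q)) (hβ : CliffordRelations β) {T : (Cl p q)ˣ} {c : Cl p q}
    (hcomm : ∀ x, Commute c x) (hc : c * c = 1) (h : Connects c β γ T) :
    top β = c * top γ := by
  have h1 := up_central_mul (γ := fun a => (↑T⁻¹ : Cl p q) * β a * T) hcomm h Finset.univ
  have h2 := up_conj (γ := β) (T := T) (fun a => rfl) Finset.univ
  have h3 : (↑T⁻¹ : Cl p q) * top β * T = top β := by
    rw [mul_assoc, (commute_top hn hβ _).eq, Units.inv_mul_cancel_left]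
  change top γ = _ at h1
  rw [h1, h2, Finset.card_univ, Fintype.card_fin, pow_eq_self_of_odd hn hc]
  change _ = c * (c * ((↑T⁻¹ : Cl p q) * top β * T))
  rw [h3, ← mul_assoc, hc, one_mul]

/-- Squaring the relation gives `η^{aa} = -η^{aa}`. -/
lemma not_connects_of_mul_self_eq_neg_one (hn : Odd (p + q)) (hβ : CliffordRelations β)
    (hγ : CliffordRelations γ) {c : Cl p q} (hcomm : ∀ x, Commute c x) (hc : c * c = -1)
    (T : (Cl p q)ˣ) : ¬ Connects c β γ T := by
  intro h
  let a : Fin (p + q) := ⟨0, hn.pos⟩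
  have h1 : γ a * γ a = -(sgn p q a • (1 : Cl p q)) := by
    calc γ a * γ a
        = c * c * ((↑T⁻¹ : Cl p q) * β a * (T * ↑T⁻¹) * β a * T) := by
          rw [h a, mul_assoc c, ← mul_assoc _ c, ← (hcomm _).eq]
          simp only [mul_assoc]
      _ = -(sgn p q a • (1 : Cl p q)) := by
        rw [Units.mul_inv, mul_one, mul_assoc (↑T⁻¹ : Cl p q), hβ.mul_self, hc, mul_smul_comm,
          mul_one, smul_mul_assoc, Units.inv_mul, neg_one_mul]
  rw [hγ.mul_self, eq_neg_iff_add_eq_zero, ← add_smul] at h1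
  have h2 := (smul_one_add_smul_vol_eq_zero (t := 0) hn (by rw [h1, zero_smul, add_zero])).1
  have := sgn_mul_self a
  nlinarith

lemma Connects.iff_exists_central (hn : Odd (p + q)) (hβ : CliffordRelations β) {c : Cl p q}
    (hc : IsUnit c) {T : (Cl p q)ˣ} (hT : Connects c β γ T) (T' : (Cl p q)ˣ) :
    Connects c β γ T' ↔ ∃ Z : (Cl p q)ˣ,
      (Z : Cl p q) ∈ Subalgebra.center ℝ (Cl p q) ∧ T' = Z * T := by
  constructor
  · intro hT'
    refine ⟨T' * T⁻¹, ?_, by group⟩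
    -- Cancelling `c`, both `T` and `T'` conjugate `β a` to the same element; so `T' T⁻¹` commutes
    -- with every `β a` and is central.
    have hcm : ∀ a, Commute (β a) (↑(T' * T⁻¹) : Cl p q) := by
      intro a
      have h1 := hc.mul_left_cancel ((hT a).symm.trans (hT' a))
      have h2 : β a = T * ((↑T⁻¹ : Cl p q) * β a * T) * ↑T⁻¹ := by
        simp only [mul_assoc, Units.mul_inv_cancel_left, Units.mul_inv, mul_one]
      have h3 : (T' : Cl p q) * ((↑T'⁻¹ : Cl p q) * β a * T') = β a * T' := by
        rw [mul_assoc, Units.mul_inv_cancel_left]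
      have h4 : (T' : Cl p q) * ((↑T⁻¹ : Cl p q) * β a * T) = β a * T' := by rw [h1, h3]
      rw [commute_iff_eq, Units.val_mul, ← mul_assoc, ← h4]
      simp only [mul_assoc, Units.mul_inv, mul_one]
    rw [Subalgebra.mem_center_iff]
    intro x
    exact (commute_of_intertwines hn hβ (fun A _ => (commute_up hcm A).eq) x).eq.symm
  · rintro ⟨Z, hZ, rfl⟩ a
    rw [Subalgebra.mem_center_iff] at hZ
    rw [hT a, mul_inv_rev, Units.val_mul, Units.val_mul]
    congr 1
    simp only [mul_assoc]
    rw [← mul_assoc (β a), hZ, mul_assoc (Z : Cl p q), Units.inv_mul_cancel_left]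

/-! ### The four candidate factors `c` -/

lemma modEq_one_or_three (hn : Odd (p + q)) :
    (p : ℤ) - q ≡ 1 [ZMOD 4] ∨ (p : ℤ) - q ≡ 3 [ZMOD 4] := by
  obtain ⟨k, hk⟩ := hn
  unfold Int.ModEq
  omega

lemma commute_of_mem (hn : Odd (p + q)) {c : Cl p q}
    (hc : c ∈ ({1, -1, vol p q, -vol p q} : Set (Cl p q))) (x : Cl p q) : Commute c x := by
  rcases hc with rfl | rfl | rfl | rfl
  · exact Commute.one_left x
  · exact (Commute.one_left x).neg_left
  · exact commute_vol hn x
  · exact (commute_vol hn x).neg_left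

lemma mul_self_of_mem_of_one (h : (p : ℤ) - q ≡ 1 [ZMOD 4]) {c : Cl p q}
    (hc : c ∈ ({1, -1, vol p q, -vol p q} : Set (Cl p q))) : c * c = 1 := by
  rcases hc with rfl | rfl | rfl | rfl
  · exact one_mul 1
  · rw [neg_mul_neg, one_mul]
  · exact vol_mul_vol_of_one h
  · rw [neg_mul_neg, vol_mul_vol_of_one h]

lemma mul_self_of_mem_pair {c : Cl p q} (hc : c ∈ ({1, -1} : Set (Cl p q))) : c * c = 1 := by
  rcases hc with rfl | rfl
  · exact one_mul 1
  · rw [neg_mul_neg, one_mul]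

lemma mul_self_of_mem_vol_pair (h : (p : ℤ) - q ≡ 3 [ZMOD 4]) {c : Cl p q}
    (hc : c ∈ ({vol p q, -vol p q} : Set (Cl p q))) : c * c = -1 := by
  rcases hc with rfl | rfl
  · exact vol_mul_vol_of_three h
  · rw [neg_mul_neg, vol_mul_vol_of_three h]

lemma eq_of_mul_top_eq (hγ : CliffordRelations γ) {c d : Cl p q}
    (h : c * top γ = d * top γ) : c = d :=
  (hγ.isUnit_up Finset.univ).mul_right_cancel h

/-- In the case `p - q ≡ 3 mod 4` the factor relating the top products is never `±e^{1…n}`. -/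
lemma top_ne_of_three (hn : Odd (p + q)) (h : (p : ℤ) - q ≡ 3 [ZMOD 4])
    (hβ : CliffordRelations β) (hγ : CliffordRelations γ) {c : Cl p q}
    (hc : c ∈ ({vol p q, -vol p q} : Set (Cl p q))) : top β ≠ c * top γ := by
  intro hb
  -- Squaring would turn `-1` on the left into `(-1)(-1) = 1` on the right.
  have h2 : top β * top β = (c * c) * (top γ * top γ) := by
    rw [hb, mul_assoc, ← mul_assoc (top γ), (commute_top hn hγ c).eq]
    simp only [mul_assoc]
  rw [hβ.top_mul_top_of_three h, hγ.top_mul_top_of_three h, mul_self_of_mem_vol_pair h hc,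
    neg_mul_neg, one_mul, eq_comm, eq_neg_iff_add_eq_zero, ← two_smul ℝ] at h2
  exact two_ne_zero (smul_one_add_smul_vol_eq_zero (r := 2) (t := 0) hn
    (by rw [h2, zero_smul, add_zero])).1

lemma existsUnique_of_exists (hγ : CliffordRelations γ) {S : Set (Cl p q)}
    (h : ∃ c ∈ S, top β = c * top γ) : ∃! c, c ∈ S ∧ top β = c * top γ := by
  obtain ⟨c, hc, hcb⟩ := h
  exact ⟨c, ⟨hc, hcb⟩, fun d hd => eq_of_mul_top_eq hγ (hd.2.symm.trans hcb)⟩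

lemma exists_factor_of_three (hn : Odd (p + q)) (h : (p : ℤ) - q ≡ 3 [ZMOD 4])
    (hβ : CliffordRelations β) (hγ : CliffordRelations γ) :
    ∃ c ∈ ({1, -1} : Set (Cl p q)), top β = c * top γ := by
  rcases top_eq_of_three hn h hβ with hb | hb <;> rcases top_eq_of_three hn h hγ with hg | hg <;>
    rw [hb, hg]
  · exact ⟨1, by simp, by simp⟩
  · exact ⟨-1, by simp, by simp⟩
  · exact ⟨-1, by simp, by simp⟩
  · exact ⟨1, by simp, by simp⟩

lemma exists_factor_of_one (hn : Odd (p + q)) (h : (p : ℤ) - q ≡ 1 [ZMOD 4])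
    (hβ : CliffordRelations β) (hγ : CliffordRelations γ) :
    ∃ c ∈ ({1, -1, vol p q, -vol p q} : Set (Cl p q)), top β = c * top γ := by
  -- As `γ^{1…n}` is its own inverse, this is the only possible factor.
  refine ⟨top β * top γ, ?_, by rw [mul_assoc, hγ.top_mul_top_of_one h, mul_one]⟩
  have hv := vol_mul_vol_of_one h
  rcases top_eq_of_one hn h hβ with (hb | hb) | (hb | hb) <;>
    rcases top_eq_of_one hn h hγ with (hg | hg) | (hg | hg) <;>
    simp [hb, hg, hv]

lemma exists_factor (hn : Odd (p + q)) (hβ : CliffordRelations β) (hγ : CliffordRelations γ) :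
    ∃ c ∈ ({1, -1, vol p q, -vol p q} : Set (Cl p q)), top β = c * top γ := by
  rcases modEq_one_or_three hn with h | h
  · exact exists_factor_of_one hn h hβ hγ
  · obtain ⟨c, hc, hcb⟩ := exists_factor_of_three hn h hβ hγ
    exact ⟨c, by rcases hc with rfl | rfl <;> simp, hcb⟩

lemma exists_connects_iff (hn : Odd (p + q)) (hβ : CliffordRelations β)
    (hγ : CliffordRelations γ) {c : Cl p q}
    (hc : c ∈ ({1, -1, vol p q, -vol p q} : Set (Cl p q))) :
    (∃ T, Connects c β γ T) ↔ top β = c * top γ := by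
  have hcomm := commute_of_mem hn hc
  rcases modEq_one_or_three hn with h | h
  · have hcc := mul_self_of_mem_of_one h hc
    refine ⟨fun ⟨T, hT⟩ => hT.top_eq hn hβ hcomm hcc, fun htop => ?_⟩
    obtain ⟨A, B, -, -, T, hT⟩ := exists_isUnit_hEven_add hn h hβ hγ
    exact ⟨T, Intertwines.connects hn hβ hγ (hT ▸ intertwines_hEven hβ hγ _) hcc htop⟩
  · have hc' : c ∈ ({1, -1} : Set (Cl p q)) ∨ c ∈ ({vol p q, -vol p q} : Set (Cl p q)) := by
      rcases hc with rfl | rfl | rfl | rfl <;> simp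
    rcases hc' with hc' | hc'
    · have hcc := mul_self_of_mem_pair hc'
      refine ⟨fun ⟨T, hT⟩ => hT.top_eq hn hβ hcomm hcc, fun htop => ?_⟩
      obtain ⟨A, -, hA0⟩ := exists_hEven_up_ne_zero hn hβ hγ
      obtain ⟨T, hT⟩ := (intertwines_hEven hβ hγ _).isUnit_of_three hn h hβ hA0
      exact ⟨T, Intertwines.connects hn hβ hγ (hT ▸ intertwines_hEven hβ hγ _) hcc htop⟩
    · refine ⟨fun ⟨T, hT⟩ => ?_, fun htop => ?_⟩
      · exact absurd hT (not_connects_of_mul_self_eq_neg_one hn hβ hγ hcomm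
          (mul_self_of_mem_vol_pair h hc') T)
      · exact absurd htop (top_ne_of_three hn h hβ hγ hc')

lemma isUnit_of_mem {c : Cl p q} (hc : c ∈ ({1, -1, vol p q, -vol p q} : Set (Cl p q))) :
    IsUnit c := by
  have hv : IsUnit (vol p q) := cliffordRelations_gen.isUnit_up Finset.univ
  rcases hc with rfl | rfl | rfl | rfl
  · exact isUnit_one
  · exact isUnit_one.neg
  · exact hv
  · exact hv.neg

end PauliOdd

end

open PauliOdd in
theorem theorem17 (p q : ℕ) (hn : Odd (p + q)) (γ β : Fin (p + q) → PauliOdd.Cl p q)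
    (hγ : PauliOdd.CliffordRelations γ) (hβ : PauliOdd.CliffordRelations β) :
    -- signature `p - q ≡ 1 mod 4`: the top products, and exactly one of the cases 1-4
    ((p : ℤ) - q ≡ 1 [ZMOD 4] →
      (∀ δ ∈ ({γ, β} : Set (Fin (p + q) → PauliOdd.Cl p q)),
        ((PauliOdd.top δ = PauliOdd.vol p q ∨ PauliOdd.top δ = -PauliOdd.vol p q) ∧
            PauliOdd.GeneratesBasis δ) ∨
          ((PauliOdd.top δ = 1 ∨ PauliOdd.top δ = -1) ∧ ¬ PauliOdd.GeneratesBasis δ)) ∧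
      ∃! c : PauliOdd.Cl p q,
        c ∈ ({1, -1, PauliOdd.vol p q, -PauliOdd.vol p q} : Set (PauliOdd.Cl p q)) ∧
          PauliOdd.top β = c * PauliOdd.top γ) ∧
    -- signature `p - q ≡ 3 mod 4`: the top products, and exactly one of the cases 1-2, never 3-4
    ((p : ℤ) - q ≡ 3 [ZMOD 4] →
      (∀ δ ∈ ({γ, β} : Set (Fin (p + q) → PauliOdd.Cl p q)),
        (PauliOdd.top δ = PauliOdd.vol p q ∨ PauliOdd.top δ = -PauliOdd.vol p q) ∧
            PauliOdd.GeneratesBasis δ) ∧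
      (∃! c : PauliOdd.Cl p q, c ∈ ({1, -1} : Set (PauliOdd.Cl p q)) ∧
          PauliOdd.top β = c * PauliOdd.top γ) ∧
      ∀ c ∈ ({PauliOdd.vol p q, -PauliOdd.vol p q} : Set (PauliOdd.Cl p q)),
        PauliOdd.top β ≠ c * PauliOdd.top γ ∧ ¬ ∃ T, PauliOdd.Connects c β γ T) ∧
    -- the four cases: existence criterion, and uniqueness up to invertible central factors
    (∀ c ∈ ({1, -1, PauliOdd.vol p q, -PauliOdd.vol p q} : Set (PauliOdd.Cl p q)),
      ((∃ T, PauliOdd.Connects c β γ T) ↔ PauliOdd.top β = c * PauliOdd.top γ) ∧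
      ∀ T, PauliOdd.Connects c β γ T → ∀ T', PauliOdd.Connects c β γ T' ↔
        ∃ Z : (PauliOdd.Cl p q)ˣ,
          (Z : PauliOdd.Cl p q) ∈ Subalgebra.center ℝ (PauliOdd.Cl p q) ∧ T' = Z * T) ∧
    -- the unified form `γ^a = (β^{1…n} γ_{1…n}) T⁻¹ β^a T` of the four cases
    (∀ T, PauliOdd.Connects (PauliOdd.top β * PauliOdd.down γ Finset.univ) β γ T ↔
      ∃ c ∈ ({1, -1, PauliOdd.vol p q, -PauliOdd.vol p q} : Set (PauliOdd.Cl p q)),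
        PauliOdd.Connects c β γ T) ∧
    -- explicit `T` for `p - q ≡ 1 mod 4`
    ((p : ℤ) - q ≡ 1 [ZMOD 4] →
      ∃ A B : Finset (Fin (p + q)), Even A.card ∧ Even B.card ∧
        ∃ T : (PauliOdd.Cl p q)ˣ,
          (T : PauliOdd.Cl p q) = PauliOdd.HEven β γ (PauliOdd.up γ A + PauliOdd.up γ B) ∧
          ∀ c ∈ ({1, -1, PauliOdd.vol p q, -PauliOdd.vol p q} : Set (PauliOdd.Cl p q)),
            PauliOdd.top β = c * PauliOdd.top γ → PauliOdd.Connects c β γ T) ∧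
    -- explicit `T` for `p - q ≡ 3 mod 4`
    ((p : ℤ) - q ≡ 3 [ZMOD 4] →
      (∃ A : Finset (Fin (p + q)), Even A.card ∧
        PauliOdd.HEven β γ (PauliOdd.up γ A) ≠ 0) ∧
      ∀ A : Finset (Fin (p + q)), Even A.card → PauliOdd.HEven β γ (PauliOdd.up γ A) ≠ 0 →
        ∃ T : (PauliOdd.Cl p q)ˣ,
          (T : PauliOdd.Cl p q) = PauliOdd.HEven β γ (PauliOdd.up γ A) ∧
          ∀ c ∈ ({1, -1} : Set (PauliOdd.Cl p q)),
            PauliOdd.top β = c * PauliOdd.top γ → PauliOdd.Connects c β γ T) := by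
  refine ⟨fun h => ⟨?_, existsUnique_of_exists hγ (exists_factor_of_one hn h hβ hγ)⟩,
    fun h => ⟨?_, existsUnique_of_exists hγ (exists_factor_of_three hn h hβ hγ), fun c hc =>
      ⟨top_ne_of_three hn h hβ hγ hc, ?_⟩⟩,
    fun c hc => ⟨exists_connects_iff hn hβ hγ hc, fun T hT T' =>
      hT.iff_exists_central hn hβ (isUnit_of_mem hc) T'⟩, fun T => ?_, fun h => ?_, fun h =>
    ⟨exists_hEven_up_ne_zero hn hβ hγ, fun A _ hA0 => ?_⟩⟩
  · intro δ hδ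
    have hδ' : CliffordRelations δ := by rcases hδ with rfl | rfl <;> assumption
    rcases top_eq_of_one hn h hδ' with ht | ht
    · exact Or.inl ⟨ht, generatesBasis_of_top_eq hn hδ' ht⟩
    · exact Or.inr ⟨ht, not_generatesBasis_of_top_eq hn ht⟩
  · intro δ hδ
    have hδ' : CliffordRelations δ := by rcases hδ with rfl | rfl <;> assumption
    have ht := top_eq_of_three hn h hδ'
    exact ⟨ht, generatesBasis_of_top_eq hn hδ' ht⟩
  · rintro ⟨T, hT⟩
    refine not_connects_of_mul_self_eq_neg_one hn hβ hγ (commute_of_mem hn ?_)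
      (mul_self_of_mem_vol_pair h hc) T hT
    rcases hc with rfl | rfl <;> simp
  -- The factor in the unified relation is the unique `c` with `β^{1…n} = c γ^{1…n}`, and any `c`
  -- with a solution of `(R_c)` is that one.
  · have hfac : ∀ c : Cl p q, top β = c * top γ → top β * down γ Finset.univ = c := by
      intro c hc
      rw [hc, mul_assoc, top, hγ.up_mul_down, mul_one]
    constructor
    · intro hT
      obtain ⟨c, hc, hcb⟩ := exists_factor hn hβ hγ
      rw [hfac c hcb] at hT
      exact ⟨c, hc, hT⟩
    · rintro ⟨c, hc, hT⟩
      rw [hfac c ((exists_connects_iff hn hβ hγ hc).1 ⟨T, hT⟩)]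
      exact hT
  · obtain ⟨A, B, hA, hB, T, hT⟩ := exists_isUnit_hEven_add hn h hβ hγ
    exact ⟨A, B, hA, hB, T, hT, fun c hc hcb => Intertwines.connects hn hβ hγ
      (hT ▸ intertwines_hEven hβ hγ _) (mul_self_of_mem_of_one h hc) hcb⟩
  · obtain ⟨T, hT⟩ := (intertwines_hEven hβ hγ _).isUnit_of_three hn h hβ hA0
    exact ⟨T, hT, fun c hc hcb => Intertwines.connects hn hβ hγ
      (hT ▸ intertwines_hEven hβ hγ _) (mul_self_of_mem_pair hc) hcb⟩
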